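/- Let $P_1,\dots,P_7\in\mathbb{P}^2_{\mathbb{C}}$ be seven distinct points in general position, meaning that no three of them lie on a line and no six of them lie on a conic. Let $\Lambda\subset|\mathcal{O}_{\mathbb{P}^2}(3)|$ be the linear system of all plane cubics passing through $P_1,\dots,P_7$. Then $\Lambda$ is a net, i.e. $\dim\Lambda=2$, and its base locus is $\mathrm{Bs}(\Lambda)=\{P_1,\dots,P_7\}$. Consequently every plane (two-dimensional linear subsystem) $\Pi\subset\Lambda$ equals $\Lambda$. Moreover, $\Pi$ contains an unruly pencil, that is, a one-dimensional linear subsystem $\ell\subset\Pi$ with the set-theoretic equality $\mathrm{Bs}(\ell)=\mathrm{Bs}(\Pi)$. More precisely, there is a cubic $C\in\Pi$ having $P_1$ as an inflection point (i.e. $C$ is smooth at $P_1$ and its tangent line $T$ there meets $C$ at $P_1$ with multiplicity at least $3$, where the multiplicity is $\infty$ if $T\subset C$) such that the system $\ell$ of all cubics of $\Pi$ tangent to $C$ at $P_1$ (i.e. meeting $T$ at $P_1$ with multiplicity at least $2$, which includes cubics singular at $P_1$) is an unruly pencil. -/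

import Mathlib

open scoped LinearAlgebra.Projectivization

noncomputable section

namespace PlaneCurves

/-- The complex projective plane. -/
abbrev P2 : Type := ℙ ℂ (Fin 3 → ℂ)

/-- Polynomials in the three homogeneous coordinates. -/
abbrev Poly : Type := MvPolynomial (Fin 3) ℂ

/-- The curve `F = 0` passes through `p`. Only used for homogeneous `F`, where the choice of the
vector representing `p` does not matter, see `passesThrough_mk_iff`. -/
def PassesThrough (F : Poly) (p : P2) : Prop :=
  MvPolynomial.eval p.rep F = 0

theorem passesThrough_mk_iff {F : Poly} {d : ℕ} (hF : F.IsHomogeneous d)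
    (v : Fin 3 → ℂ) (hv : v ≠ 0) :
    PassesThrough F (Projectivization.mk ℂ v hv) ↔ MvPolynomial.eval v F = 0 := by
  obtain ⟨a, ha⟩ := Projectivization.exists_smul_eq_mk_rep ℂ v hv
  unfold PassesThrough
  rw [← ha, Units.smul_def]
  have h : MvPolynomial.eval ((a : ℂ) • v) F = (a : ℂ) ^ d * MvPolynomial.eval v F := by
    rw [MvPolynomial.eval_eq', MvPolynomial.eval_eq', Finset.mul_sum]
    refine Finset.sum_congr rfl fun m hm => ?_
    have hd : ∑ i, m i = d := by
      rw [← Finsupp.degree_eq_sum]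
      exact hF.degree_eq_sum_deg_support hm |>.symm
    simp only [Pi.smul_apply, smul_eq_mul, mul_pow, Finset.prod_mul_distrib,
      Finset.prod_pow_eq_pow_sum, hd]
    ring
  rw [h]
  simp

/-- No `k` of the points `P i` (with `k` different indices) lie on a plane curve of degree `d`. -/
def NoneOnCurve {n : ℕ} (P : Fin n → P2) (k d : ℕ) : Prop :=
  ∀ S : Finset (Fin n), S.card = k → ∀ F : Poly, F.IsHomogeneous d → F ≠ 0 →
    ∃ i ∈ S, ¬ PassesThrough F (P i)

/-- Distinct points in general position: no three on a line and no six on a conic. -/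
structure GeneralPosition {n : ℕ} (P : Fin n → P2) : Prop where
  injective : Function.Injective P
  no_three_on_line : NoneOnCurve P 3 1
  no_six_on_conic : NoneOnCurve P 6 2

/-- The linear system of all plane cubics through the points `P i`, as a vector space of cubic
forms; its projective dimension is the dimension of this space minus one. -/
def cubicsThrough {n : ℕ} (P : Fin n → P2) : Submodule ℂ Poly where
  carrier := {F | F.IsHomogeneous 3 ∧ ∀ i, PassesThrough F (P i)}
  zero_mem' := ⟨MvPolynomial.isHomogeneous_zero _ _ _, fun i => by simp [PassesThrough]⟩
  add_mem' := fun {F G} hF hG => ⟨hF.1.add hG.1, fun i => by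
    have h1 := hF.2 i
    have h2 := hG.2 i
    unfold PassesThrough at *
    simp [h1, h2]⟩
  smul_mem' := fun c F hF =>
    ⟨(MvPolynomial.homogeneousSubmodule (Fin 3) ℂ 3).smul_mem c hF.1, fun i => by
      have h1 := hF.2 i
      unfold PassesThrough at *
      simp [h1]⟩

/-- The set-theoretic base locus of a linear system. -/
def baseLocus (V : Submodule ℂ Poly) : Set P2 :=
  {p | ∀ F ∈ V, PassesThrough F p}

/-- `V` is an unruly pencil in the linear system `W`: a one-dimensional linear subsystem
with the same set-theoretic base locus as `W`. -/
structure IsUnrulyPencil (V W : Submodule ℂ Poly) : Prop where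
  le : V ≤ W
  finrank_eq : Module.finrank ℂ V = 2
  baseLocus_eq : baseLocus V = baseLocus W

/-- The differential of `F` at (the chosen representative of) `p`, applied to `v`. If `F = 0` is
smooth at `p`, its zeros `v` are the points of the projective tangent line at `p`. -/
def differential (F : Poly) (p : P2) (v : Fin 3 → ℂ) : ℂ :=
  ∑ i, MvPolynomial.eval p.rep (MvPolynomial.pderiv i F) * v i

/-- The curve `F = 0` passes through `p` and is smooth there. -/
def IsSmoothPoint (F : Poly) (p : P2) : Prop :=
  PassesThrough F p ∧ ∃ v, differential F p v ≠ 0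

/-- The one-variable polynomial `F (p + t v)` in `t`: the restriction of `F` to the line joining
`p` and `v`. Its order of vanishing at `t = 0` is the intersection multiplicity at `p` of
that line and the curve `F = 0`. -/
def restrictToLine (F : Poly) (p : P2) (v : Fin 3 → ℂ) : Polynomial ℂ :=
  MvPolynomial.aeval
    (fun i => Polynomial.C (p.rep i) + Polynomial.C (v i) * Polynomial.X) F

/-- `p` is an inflection point of the curve `F = 0`: a smooth point at which the tangent line meets
the curve with multiplicity at least three. -/
def IsInflectionPoint (F : Poly) (p : P2) : Prop :=
  IsSmoothPoint F p ∧
    ∀ v, differential F p v = 0 → Polynomial.X ^ 3 ∣ restrictToLine F p v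

/-- For `C = 0` smooth at `p`: the curve `Z = 0` passes through `p` and touches there the tangent
line of `C = 0`, that is, it meets this line at `p` with multiplicity at least two (so it has the
same tangent line at `p`, or it is singular at `p`). -/
def IsTangentTo (Z C : Poly) (p : P2) : Prop :=
  PassesThrough Z p ∧ ∀ v, differential C p v = 0 → differential Z p v = 0

end PlaneCurves

end

/-!
The linear system of cubics through the seven points is a net because the points impose independent
conditions: six of them lie on three lines that avoid the seventh
(`NoneOnCurve.exists_cubic`, `finrank_cubicsThrough`).

For the unruly pencil, take coordinates in which `P 0` is `(0, 0, 1)`. A cubic of the net is then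
`z² L + z Q + K` with binary forms `L`, `Q`, `K` in `x`, `y`. Some cubic `N = z q + c` of the net is
singular at `P 0`. It contains no line through `P 0`, since the residual conic would pass through
six of the points; so `q` and `c` have no common zero (`GeneralPosition.not_common_zero`), and `N`
is parametrized by `(x, y) ↦ (x q, y q, -c)`. Restricted to `N`, a cubic of the net becomes `q` times
the form `L c² - q Q c + q² K` of degree seven, which vanishes at the parameters of the six points
`P i`, `i ≠ 0`, and has one more zero (`GeneralPosition.exists_residual_eq`).

Two cubics of the net that consist of a line through `P 0` and a conic have different tangents at
`P 0`. So every nontrivial combination `H` of them is smooth there, and one can be chosen whose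
additional zero is again the parameter of `P 1` (`GeneralPosition.exists_cubic_residual_zeros`).
Then `N` and `H` meet in the seven points only. The tangent direction `T` of `H` at `P 0` is not a
zero of `q`: otherwise `T` would be a zero of the form of degree seven, hence the parameter of some
`P i`, but `q` does not vanish at these. Therefore
`H + k N` has an inflection point at `P 0` for a suitable `k`. The cubics of the net that are tangent
to `T` at `P 0` form a pencil containing `N` and `H`, so its base locus, and a fortiori that of the
net, consists of the seven points (`GeneralPosition.exists_unruly_pencil`).
-/

open scoped LinearAlgebra.Projectivization

noncomputable section

open MvPolynomial

namespace PlaneCurves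

/-! ### Binary forms -/

/-- `f` is a binary form of degree `n`. Forms are encoded as functions of two variables, so that
identities between them can be checked pointwise; a form of degree `n + 1` is `x g + y h` with
forms `g`, `h` of degree `n`. -/
def IsBinaryForm : ℕ → (ℂ → ℂ → ℂ) → Prop
  | 0, f => ∃ c, ∀ x y, f x y = c
  | n + 1, f => ∃ g h, IsBinaryForm n g ∧ IsBinaryForm n h ∧ ∀ x y, f x y = x * g x y + y * h x y

namespace IsBinaryForm

variable {m n : ℕ} {f g : ℂ → ℂ → ℂ}

theorem congr (hf : IsBinaryForm n f) (h : ∀ x y, g x y = f x y) : IsBinaryForm n g := by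
  obtain rfl : g = f := funext fun x => funext fun y => h x y
  exact hf

theorem smul (hf : IsBinaryForm n f) (c : ℂ) : IsBinaryForm n fun x y => c * f x y := by
  induction n generalizing f with
  | zero =>
    obtain ⟨d, hd⟩ := hf
    exact ⟨c * d, fun x y => by simp [hd]⟩
  | succ n ih =>
    obtain ⟨g, h, hg, hh, e⟩ := hf
    exact ⟨_, _, ih hg, ih hh, fun x y => by simp only [e]; ring⟩

theorem add (hf : IsBinaryForm n f) (hg : IsBinaryForm n g) :
    IsBinaryForm n fun x y => f x y + g x y := by
  induction n generalizing f g with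
  | zero =>
    obtain ⟨c, hc⟩ := hf
    obtain ⟨d, hd⟩ := hg
    exact ⟨c + d, fun x y => by simp [hc, hd]⟩
  | succ n ih =>
    obtain ⟨f₁, f₂, h₁, h₂, e⟩ := hf
    obtain ⟨g₁, g₂, k₁, k₂, e'⟩ := hg
    exact ⟨_, _, ih h₁ k₁, ih h₂ k₂, fun x y => by simp only [e, e']; ring⟩

theorem zero (n : ℕ) : IsBinaryForm n fun _ _ => 0 := by
  induction n with
  | zero => exact ⟨0, fun _ _ => rfl⟩
  | succ n ih => exact ⟨_, _, ih, ih, fun x y => by ring⟩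

theorem const (c : ℂ) : IsBinaryForm 0 fun _ _ => c := ⟨c, fun _ _ => rfl⟩

theorem linear (a b : ℂ) : IsBinaryForm 1 fun x y => a * x + b * y :=
  ⟨_, _, const a, const b, fun x y => by ring⟩

theorem mul (hf : IsBinaryForm m f) (hg : IsBinaryForm n g) :
    IsBinaryForm (m + n) fun x y => f x y * g x y := by
  induction m generalizing f with
  | zero =>
    obtain ⟨c, hc⟩ := hf
    rw [Nat.zero_add]
    exact (hg.smul c).congr fun x y => by rw [hc]
  | succ m ih =>
    obtain ⟨f₁, f₂, h₁, h₂, e⟩ := hf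
    rw [Nat.add_right_comm]
    exact ⟨_, _, ih h₁, ih h₂, fun x y => by simp only [e]; ring⟩

theorem comp_linear (hf : IsBinaryForm n f) (a b c d : ℂ) :
    IsBinaryForm n fun x y => f (a * x + b * y) (c * x + d * y) := by
  induction n generalizing f with
  | zero =>
    obtain ⟨e, he⟩ := hf
    exact ⟨e, fun x y => he _ _⟩
  | succ n ih =>
    obtain ⟨g, h, hg, hh, e⟩ := hf
    have := ((linear a b).mul (ih hg)).add ((linear c d).mul (ih hh))
    rw [Nat.add_comm] at this
    exact this.congr fun x y => e _ _

theorem map_smul (hf : IsBinaryForm n f) (c x y : ℂ) : f (c * x) (c * y) = c ^ n * f x y := by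
  induction n generalizing f with
  | zero =>
    obtain ⟨e, he⟩ := hf
    simp [he]
  | succ n ih =>
    obtain ⟨g, h, hg, hh, e⟩ := hf
    rw [e, e, ih hg, ih hh]
    ring

theorem map_zero (hf : IsBinaryForm (n + 1) f) : f 0 0 = 0 := by
  simpa using hf.map_smul 0 0 0

theorem exists_eq_linear (hf : IsBinaryForm 1 f) : ∃ a b, ∀ x y, f x y = a * x + b * y := by
  obtain ⟨g, h, ⟨a, ha⟩, ⟨b, hb⟩, e⟩ := hf
  exact ⟨a, b, fun x y => by rw [e, ha, hb]; ring⟩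

/-- Every monomial except `x ^ (n + 1)` is divisible by `y`. -/
theorem exists_eq_mul_add (hf : IsBinaryForm (n + 1) f) :
    ∃ g c, IsBinaryForm n g ∧ ∀ x y, f x y = y * g x y + c * x ^ (n + 1) := by
  induction n generalizing f with
  | zero =>
    obtain ⟨a, b, h⟩ := hf.exists_eq_linear
    exact ⟨_, a, const b, fun x y => by rw [h]; ring⟩
  | succ n ih =>
    obtain ⟨g, h, hg, hh, e⟩ := hf
    obtain ⟨k, c, hk, e'⟩ := ih hg
    have hxk : IsBinaryForm (n + 1) fun x y => x * k x y :=
      ⟨_, _, hk, zero n, fun x y => by ring⟩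
    exact ⟨_, c, hxk.add hh, fun x y => by rw [e, e']; ring⟩

end IsBinaryForm

theorem exists_det_eq_one {a b : ℂ} (h : a ≠ 0 ∨ b ≠ 0) : ∃ c d, a * d - b * c = 1 := by
  rcases h with h | h
  · exact ⟨0, a⁻¹, by simp [h]⟩
  · exact ⟨-b⁻¹, 0, by simp [h]⟩

theorem eq_mul_of_det_eq_zero {a b x y : ℂ} (h : a ≠ 0 ∨ b ≠ 0) (hdet : x * b - y * a = 0) :
    ∃ c, x = c * a ∧ y = c * b := by
  obtain ⟨w, z, hwz⟩ := exists_det_eq_one h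
  refine ⟨x * z - y * w, ?_, ?_⟩
  · linear_combination (-x) * hwz - w * hdet
  · linear_combination (-y) * hwz - z * hdet

namespace IsBinaryForm

variable {m n : ℕ} {f g : ℂ → ℂ → ℂ}

theorem exists_eq_linear_mul (hf : IsBinaryForm (n + 1) f) {a b : ℂ} (hab : a ≠ 0 ∨ b ≠ 0)
    (h0 : f a b = 0) : ∃ g, IsBinaryForm n g ∧ ∀ x y, f x y = (x * b - y * a) * g x y := by
  -- In coordinates in which the zero is `(1, 0)`, the coefficient of `x ^ (n + 1)` vanishes.
  obtain ⟨w, z, hwz⟩ := exists_det_eq_one hab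
  obtain ⟨g, c, hg, e⟩ := (hf.comp_linear a w b z).exists_eq_mul_add
  have hc : c = 0 := by simpa [h0] using (e 1 0).symm
  refine ⟨_, (hg.comp_linear z (-w) (-b) a).smul (-1), fun x y => ?_⟩
  have := e (z * x + (-w) * y) ((-b) * x + a * y)
  rw [hc] at this
  have hx : a * (z * x + -w * y) + w * (-b * x + a * y) = x := by linear_combination x * hwz
  have hy : b * (z * x + -w * y) + z * (-b * x + a * y) = y := by linear_combination y * hwz
  rw [hx, hy] at this
  rw [this]
  ring

theorem exists_eq_prod_mul {ι : Type*} {a b : ι → ℂ} (S : Finset ι)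
    (hf : IsBinaryForm (n + S.card) f) (hab : ∀ i ∈ S, a i ≠ 0 ∨ b i ≠ 0)
    (h0 : ∀ i ∈ S, f (a i) (b i) = 0)
    (hdet : ∀ i ∈ S, ∀ j ∈ S, i ≠ j → a i * b j - b i * a j ≠ 0) :
    ∃ g, IsBinaryForm n g ∧ ∀ x y, f x y = (∏ i ∈ S, (x * b i - y * a i)) * g x y := by
  classical
  induction S using Finset.induction_on generalizing f with
  | empty => exact ⟨f, hf, fun x y => by simp⟩
  | insert i S hi ih =>
    rw [Finset.card_insert_of_notMem hi, ← Nat.add_assoc] at hf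
    obtain ⟨g, hg, e⟩ := hf.exists_eq_linear_mul (hab i (S.mem_insert_self i))
      (h0 i (S.mem_insert_self i))
    have hg0 : ∀ j ∈ S, g (a j) (b j) = 0 := fun j hj => by
      have := h0 j (Finset.mem_insert_of_mem hj)
      rw [e] at this
      exact (mul_eq_zero.1 this).resolve_left
        (hdet j (Finset.mem_insert_of_mem hj) i (S.mem_insert_self i) (by rintro rfl; exact hi hj))
    obtain ⟨k, hk, e'⟩ := ih hg (fun j hj => hab j (Finset.mem_insert_of_mem hj)) hg0
      (fun j hj l hl => hdet j (Finset.mem_insert_of_mem hj) l (Finset.mem_insert_of_mem hl))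
    exact ⟨k, hk, fun x y => by rw [e, e', Finset.prod_insert hi, mul_assoc]⟩

/-- A nonzero linear form can be cancelled. -/
theorem eq_zero_of_linear_mul (hf : IsBinaryForm n f) {a b : ℂ} (hab : a ≠ 0 ∨ b ≠ 0)
    (h : ∀ x y, (x * b - y * a) * f x y = 0) (x y : ℂ) : f x y = 0 := by
  -- The form vanishes at the points `(w, z) + k (a, b)`, no two of which are proportional.
  obtain ⟨w, z, hwz⟩ := exists_det_eq_one hab
  have hv : ∀ k : ℕ, f (w + k * a) (z + k * b) = 0 := fun k =>
    (mul_eq_zero.1 (h (w + k * a) (z + k * b))).resolve_left (by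
      rw [show (w + k * a) * b - (z + k * b) * a = -1 by linear_combination -hwz]
      norm_num)
  have hdet : ∀ i j : ℕ, i ≠ j →
      (w + i * a) * (z + j * b) - (z + i * b) * (w + j * a) ≠ 0 := fun i j hij => by
    rw [show (w + i * a) * (z + j * b) - (z + i * b) * (w + j * a) = (i : ℂ) - j by
      linear_combination ((i : ℂ) - j) * hwz, sub_ne_zero]
    exact_mod_cast hij
  have hne : ∀ k : ℕ, w + k * a ≠ 0 ∨ z + k * b ≠ 0 := fun k => by
    by_contra hc
    push Not at hc
    exact hdet k (k + 1) (by simp) (by rw [hc.1, hc.2]; ring)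
  obtain ⟨g, ⟨c, hc⟩, e⟩ := exists_eq_prod_mul (n := 0) (Finset.range n)
    (a := fun k : ℕ => w + k * a) (b := fun k : ℕ => z + k * b) (by simpa using hf)
    (fun i _ => hne i) (fun i _ => hv i) (fun i _ j _ => hdet i j)
  have hn := hv n
  rw [e, hc] at hn
  have hc0 : c = 0 := (mul_eq_zero.1 hn).resolve_left
    (Finset.prod_ne_zero_iff.2 fun i hi => hdet n i (Finset.mem_range.1 hi).ne')
  rw [e, hc, hc0, mul_zero]

theorem exists_polynomial (hf : IsBinaryForm n f) :
    ∃ p : Polynomial ℂ, (∀ x, f x 1 = p.eval x) ∧ p.natDegree ≤ n ∧ p.coeff n = f 1 0 := by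
  induction n generalizing f with
  | zero =>
    obtain ⟨c, hc⟩ := hf
    exact ⟨.C c, fun x => by simp [hc], by simp, by simp [hc]⟩
  | succ n ih =>
    obtain ⟨g, h, hg, hh, e⟩ := hf
    obtain ⟨p, hp, hpd, hpc⟩ := ih hg
    obtain ⟨q, hq, hqd, -⟩ := ih hh
    refine ⟨.X * p + q, fun x => by simp [e, hp, hq], ?_, ?_⟩
    · exact (Polynomial.natDegree_add_le _ _).trans (max_le
        ((Polynomial.natDegree_mul_le).trans (by rw [Polynomial.natDegree_X]; omega)) (by omega))
    · rw [Polynomial.coeff_add, Polynomial.coeff_X_mul, hpc,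
        Polynomial.coeff_eq_zero_of_natDegree_lt (by omega : q.natDegree < n + 1), e]
      ring

theorem exists_root (hf : IsBinaryForm (n + 1) f) : ∃ a b, (a ≠ 0 ∨ b ≠ 0) ∧ f a b = 0 := by
  by_cases h : f 1 0 = 0
  · exact ⟨1, 0, by simp, h⟩
  obtain ⟨p, hp, hd, hc⟩ := hf.exists_polynomial
  have hdeg : p.degree ≠ 0 := by
    intro h0
    have hn : p.natDegree = 0 := Polynomial.natDegree_eq_of_degree_eq_some h0
    exact h (hc ▸ Polynomial.coeff_eq_zero_of_natDegree_lt (hn ▸ n.succ_pos))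
  obtain ⟨x, hx⟩ := IsAlgClosed.exists_root p hdeg
  exact ⟨x, 1, by simp, by rw [hp]; exact hx⟩

end IsBinaryForm

/-! ### Spaces of plane curves -/

theorem finrank_homogeneousSubmodule (d : ℕ) :
    Module.finrank ℂ (homogeneousSubmodule (Fin 3) ℂ d) = (d + 2).choose d := by
  have hset : {m : Fin 3 →₀ ℕ | m.degree = d} = ((Finset.univ : Finset (Fin 3)).finsuppAntidiag d :
      Finset (Fin 3 →₀ ℕ)) := by
    ext m
    simp [Finsupp.degree_eq_sum]
  have hcard := Finset.card_finsuppAntidiag_nat_eq_choose (s := (Finset.univ : Finset (Fin 3))) d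
  rw [homogeneousSubmodule_eq_finsupp_supported, hset]
  rw [LinearEquiv.finrank_eq (AddMonoidAlgebra.supportedEquivFinsupp _)]
  rw [Module.finrank_finsupp_self, Fintype.card_eq_nat_card, Nat.card_coe_set_eq,
    Set.ncard_coe_finset, hcard, Finset.card_univ, Fintype.card_fin]
  congr 1
  omega

instance (d : ℕ) : FiniteDimensional ℂ (homogeneousSubmodule (Fin 3) ℂ d) :=
  Module.finite_of_finrank_pos (by
    rw [finrank_homogeneousSubmodule]
    exact Nat.choose_pos (by omega))

/-- Evaluation of forms of degree `d` at representatives of the points `P i`. -/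
def evalAt (d : ℕ) {ι : Type*} (P : ι → P2) : homogeneousSubmodule (Fin 3) ℂ d →ₗ[ℂ] ι → ℂ :=
  LinearMap.pi fun i => (aeval (P i).rep).toLinearMap ∘ₗ Submodule.subtype _

theorem evalAt_apply {d : ℕ} {ι : Type*} (P : ι → P2) (F : homogeneousSubmodule (Fin 3) ℂ d)
    (i : ι) : evalAt d P F i = eval (P i).rep F.1 := by
  simp [evalAt, aeval_eq_eval]

theorem exists_curve_passesThrough {n : ℕ} (P : Fin n → P2) (S : Finset (Fin n)) {d : ℕ}
    (hS : S.card < (d + 2).choose d) :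
    ∃ F : Poly, F.IsHomogeneous d ∧ F ≠ 0 ∧ ∀ i ∈ S, PassesThrough F (P i) := by
  have hker : LinearMap.ker (evalAt d fun i : S => P i) ≠ ⊥ :=
    LinearMap.ker_ne_bot_of_finrank_lt (by
      rw [finrank_homogeneousSubmodule, Module.finrank_fintype_fun_eq_card, Fintype.card_coe]
      exact hS)
  obtain ⟨F, hF, hF0⟩ := Submodule.exists_mem_ne_zero_of_ne_bot hker
  refine ⟨F.1, F.2, fun h => hF0 (Subtype.ext h), fun i hi => ?_⟩
  have := congrFun (LinearMap.mem_ker.1 hF) ⟨i, hi⟩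
  rwa [evalAt_apply] at this

theorem passesThrough_mul {F G : Poly} {p : P2} :
    PassesThrough (F * G) p ↔ PassesThrough F p ∨ PassesThrough G p := by
  simp [PassesThrough]

/-- If no three points are collinear, two of them lie on a line that avoids a third one. -/
theorem NoneOnCurve.exists_line {n : ℕ} {P : Fin n → P2} (h : NoneOnCurve P 3 1) {i j k : Fin n}
    (hij : i ≠ j) (hik : i ≠ k) (hjk : j ≠ k) :
    ∃ F : Poly, F.IsHomogeneous 1 ∧ PassesThrough F (P j) ∧ PassesThrough F (P k) ∧
      ¬ PassesThrough F (P i) := by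
  obtain ⟨F, hF, hF0, hS⟩ := exists_curve_passesThrough P {j, k} (d := 1)
    (by rw [Finset.card_pair hjk]; decide)
  have hj := hS j (by simp)
  have hk := hS k (by simp)
  obtain ⟨l, hl, hFl⟩ := h {i, j, k}
    (Finset.card_eq_three.2 ⟨i, j, k, hij, hik, hjk, rfl⟩) F hF hF0
  simp only [Finset.mem_insert, Finset.mem_singleton] at hl
  rcases hl with rfl | rfl | rfl
  · exact ⟨F, hF, hj, hk, hFl⟩
  · exact absurd hj hFl
  · exact absurd hk hFl

/-- Six of the seven points lie on three lines which avoid the seventh. -/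
theorem NoneOnCurve.exists_cubic {P : Fin 7 → P2} (h : NoneOnCurve P 3 1) (i : Fin 7) :
    ∃ F : Poly, F.IsHomogeneous 3 ∧ (∀ j, j ≠ i → PassesThrough F (P j)) ∧
      ¬ PassesThrough F (P i) := by
  have hne : ∀ i : Fin 7, (i ≠ i + 1 ∧ i ≠ i + 2 ∧ i + 1 ≠ i + 2) ∧
      (i ≠ i + 3 ∧ i ≠ i + 4 ∧ i + 3 ≠ i + 4) ∧ (i ≠ i + 5 ∧ i ≠ i + 6 ∧ i + 5 ≠ i + 6) := by
    decide
  have hcover : ∀ i j : Fin 7, j ≠ i → j = i + 1 ∨ j = i + 2 ∨ j = i + 3 ∨ j = i + 4 ∨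
      j = i + 5 ∨ j = i + 6 := by decide
  obtain ⟨⟨a₁, a₂, a₃⟩, ⟨b₁, b₂, b₃⟩, ⟨c₁, c₂, c₃⟩⟩ := hne i
  obtain ⟨A, hA, hA₁, hA₂, hA₃⟩ := h.exists_line a₁ a₂ a₃
  obtain ⟨B, hB, hB₁, hB₂, hB₃⟩ := h.exists_line b₁ b₂ b₃
  obtain ⟨C, hC, hC₁, hC₂, hC₃⟩ := h.exists_line c₁ c₂ c₃
  refine ⟨A * B * C, (hA.mul hB).mul hC, fun j hj => ?_, ?_⟩
  · simp only [passesThrough_mul]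
    rcases hcover i j hj with rfl | rfl | rfl | rfl | rfl | rfl <;> tauto
  · simp only [passesThrough_mul]
    tauto

theorem evalAt_surjective {P : Fin 7 → P2} (h : NoneOnCurve P 3 1) :
    Function.Surjective (evalAt 3 P) := by
  intro f
  choose F hF hFj hFi using h.exists_cubic
  refine ⟨∑ i, (f i / eval (P i).rep (F i)) • ⟨F i, hF i⟩, funext fun j => ?_⟩
  rw [map_sum, Finset.sum_apply, Finset.sum_eq_single j]
  · rw [map_smul, Pi.smul_apply, evalAt_apply]
    exact div_mul_cancel₀ _ (hFi j)
  · intro i _ hij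
    rw [map_smul, Pi.smul_apply, evalAt_apply, smul_eq_mul]
    exact mul_eq_zero_of_right _ (hFj i j hij.symm)
  · simp

theorem cubicsThrough_eq_map_ker {n : ℕ} (P : Fin n → P2) :
    cubicsThrough P = (LinearMap.ker (evalAt 3 P)).map (Submodule.subtype _) := by
  ext F
  constructor
  · intro hF
    refine ⟨⟨F, hF.1⟩, ?_, rfl⟩
    rw [SetLike.mem_coe, LinearMap.mem_ker]
    ext i
    rw [evalAt_apply]
    exact hF.2 i
  · rintro ⟨F, hF, rfl⟩
    refine ⟨F.2, fun i => ?_⟩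
    have h := congrFun (LinearMap.mem_ker.1 hF) i
    rw [evalAt_apply] at h
    exact h

instance {n : ℕ} (P : Fin n → P2) : FiniteDimensional ℂ (cubicsThrough P) := by
  rw [cubicsThrough_eq_map_ker]
  infer_instance

theorem finrank_cubicsThrough {P : Fin 7 → P2} (h : NoneOnCurve P 3 1) :
    Module.finrank ℂ (cubicsThrough P) = 3 := by
  have := LinearMap.finrank_range_add_finrank_ker (evalAt 3 P)
  rw [LinearMap.range_eq_top.2 (evalAt_surjective h), finrank_top, finrank_homogeneousSubmodule,
    Module.finrank_fintype_fun_eq_card, Fintype.card_fin] at this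
  rw [cubicsThrough_eq_map_ker, Submodule.finrank_map_subtype_eq]
  exact Nat.add_left_cancel (n := 7) this

/-! ### Coordinates centred at a point -/

/-- Homogeneous coordinates `x`, `y`, `z` on the plane in which the point `p` is `(0, 0, 1)`: a
basis `u`, `w`, `p.rep` of `ℂ³` together with the dual linear forms. That `z` takes the value `c` at
`a u + b w + c p.rep` follows from the other laws, and is not a field. -/
structure Frame (p : P2) where
  (u w : Fin 3 → ℂ)
  (x y z : Poly)
  isHomogeneous_x : x.IsHomogeneous 1
  isHomogeneous_y : y.IsHomogeneous 1
  isHomogeneous_z : z.IsHomogeneous 1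
  eq_sum : ∀ v, v = eval v x • u + eval v y • w + eval v z • p.rep
  eval_x : ∀ a b c : ℂ, eval (a • u + b • w + c • p.rep) x = a
  eval_y : ∀ a b c : ℂ, eval (a • u + b • w + c • p.rep) y = b

instance (p : P2) : Nonempty (Frame p) := by
  obtain ⟨e, he⟩ := SeparatingDual.exists_continuousLinearEquiv_apply_eq (R := ℂ)
    (x := (Pi.single 2 1 : Fin 3 → ℂ)) (y := p.rep) (by simp) p.rep_nonzero
  let c : Fin 3 → Poly := fun k => ∑ i, C (e.symm (Pi.single i 1) k) * X i
  have hc : ∀ k, (c k).IsHomogeneous 1 := fun k =>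
    IsHomogeneous.sum _ _ _ fun i _ => isHomogeneous_C_mul_X _ _
  have hev : ∀ k v, eval v (c k) = e.symm v k := fun k v => by
    conv_rhs => rw [pi_eq_sum_univ' v]
    simp [c, mul_comm]
  have hsymm : ∀ a b d : ℂ, e.symm (a • e (Pi.single 0 1) + b • e (Pi.single 1 1) + d • p.rep) =
      a • Pi.single 0 1 + b • Pi.single 1 1 + d • Pi.single 2 1 := fun a b d => by
    rw [← he]
    simp
  refine ⟨⟨e (Pi.single 0 1), e (Pi.single 1 1), c 0, c 1, c 2, hc 0, hc 1, hc 2, fun v => ?_,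
    fun a b d => ?_, fun a b d => ?_⟩⟩
  · apply e.symm.injective
    rw [hsymm, hev, hev, hev]
    ext i
    fin_cases i <;> simp
  all_goals rw [hev, hsymm]; simp

namespace Frame

variable {p : P2} (fr : Frame p)

/-- The point with coordinates `x`, `y`, `z` in the frame. -/
def pt (a b c : ℂ) : Fin 3 → ℂ := a • fr.u + b • fr.w + c • p.rep

theorem eq_pt (v : Fin 3 → ℂ) : v = fr.pt (eval v fr.x) (eval v fr.y) (eval v fr.z) := fr.eq_sum v

@[simp] theorem eval_pt_x (a b c : ℂ) : eval (fr.pt a b c) fr.x = a := fr.eval_x a b c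
@[simp] theorem eval_pt_y (a b c : ℂ) : eval (fr.pt a b c) fr.y = b := fr.eval_y a b c

theorem pt_zero_zero_one : fr.pt 0 0 1 = p.rep := by simp [pt]

end Frame

/-- The binary form `f` in two given linear forms, as a polynomial. -/
theorem IsBinaryForm.exists_poly {n : ℕ} {f : ℂ → ℂ → ℂ} (hf : IsBinaryForm n f) {X Y : Poly}
    (hX : X.IsHomogeneous 1) (hY : Y.IsHomogeneous 1) :
    ∃ F : Poly, F.IsHomogeneous n ∧ ∀ v, eval v F = f (eval v X) (eval v Y) := by
  induction n generalizing f with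
  | zero =>
    obtain ⟨c, hc⟩ := hf
    exact ⟨C c, isHomogeneous_C _ _, fun v => by simp [hc]⟩
  | succ n ih =>
    obtain ⟨g, h, hg, hh, e⟩ := hf
    obtain ⟨G, hG, eG⟩ := ih hg
    obtain ⟨H, hH, eH⟩ := ih hh
    refine ⟨X * G + Y * H, ?_, fun v => by simp [e, eG, eH]⟩
    rw [Nat.add_comm]
    exact (hX.mul hG).add (hY.mul hH)

/-- `g` is a ternary form of degree `n`, given by its expansion
`g = z (⋯ (z (z f₀ + f₁) + f₂) ⋯) + fₙ` with binary forms `fᵢ` in `x`, `y`. -/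
def IsTernaryForm : ℕ → (ℂ → ℂ → ℂ → ℂ) → Prop
  | 0, g => ∃ c, ∀ x y z, g x y z = c
  | n + 1, g => ∃ h f, IsTernaryForm n h ∧ IsBinaryForm (n + 1) f ∧
      ∀ x y z, g x y z = z * h x y z + f x y

namespace IsTernaryForm

variable {n : ℕ} {f g : ℂ → ℂ → ℂ → ℂ}

theorem congr (hf : IsTernaryForm n f) (h : ∀ x y z, g x y z = f x y z) : IsTernaryForm n g := by
  obtain rfl : g = f := funext fun x => funext fun y => funext fun z => h x y z
  exact hf

theorem add (hf : IsTernaryForm n f) (hg : IsTernaryForm n g) :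
    IsTernaryForm n fun x y z => f x y z + g x y z := by
  induction n generalizing f g with
  | zero =>
    obtain ⟨c, hc⟩ := hf
    obtain ⟨d, hd⟩ := hg
    exact ⟨c + d, fun x y z => by simp [hc, hd]⟩
  | succ n ih =>
    obtain ⟨f₁, f₂, h₁, h₂, e⟩ := hf
    obtain ⟨g₁, g₂, k₁, k₂, e'⟩ := hg
    exact ⟨_, _, ih h₁ k₁, h₂.add k₂, fun x y z => by simp only [e, e']; ring⟩

theorem smul (hf : IsTernaryForm n f) (c : ℂ) : IsTernaryForm n fun x y z => c * f x y z := by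
  induction n generalizing f with
  | zero =>
    obtain ⟨d, hd⟩ := hf
    exact ⟨c * d, fun x y z => by simp [hd]⟩
  | succ n ih =>
    obtain ⟨h, k, hh, hk, e⟩ := hf
    exact ⟨_, _, ih hh, hk.smul c, fun x y z => by simp only [e]; ring⟩

theorem linear_mul (hf : IsTernaryForm n f) (a b c : ℂ) :
    IsTernaryForm (n + 1) fun x y z => (a * x + b * y + c * z) * f x y z := by
  have hxy : IsTernaryForm (n + 1) fun x y z => (a * x + b * y) * f x y z := by
    induction n generalizing f with
    | zero =>
      obtain ⟨d, hd⟩ := hf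
      exact ⟨_, _, ⟨0, fun _ _ _ => rfl⟩, (IsBinaryForm.linear a b).smul d,
        fun x y z => by simp only [hd]; ring⟩
    | succ n ih =>
      obtain ⟨h, k, hh, hk, e⟩ := hf
      have := (IsBinaryForm.linear a b).mul hk
      rw [Nat.add_comm] at this
      exact ⟨_, _, ih hh, this, fun x y z => by simp only [e]; ring⟩
  have hz : IsTernaryForm (n + 1) fun x y z => z * (c * f x y z) :=
    ⟨_, _, hf.smul c, .zero _, fun x y z => by ring⟩
  exact (hxy.add hz).congr fun x y z => by ring

end IsTernaryForm

theorem Frame.isTernaryForm {p : P2} (fr : Frame p) {n : ℕ} {F : Poly} (hF : F.IsHomogeneous n) :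
    IsTernaryForm n fun a b c => eval (fr.pt a b c) F := by
  induction n generalizing F with
  | zero =>
    obtain ⟨c, rfl⟩ : ∃ c, F = C c := ⟨_, totalDegree_eq_zero_iff_eq_C.1
      ((totalDegree_zero_iff_isHomogeneous _).2 hF)⟩
    exact ⟨c, fun x y z => by simp⟩
  | succ n ih =>
    -- Euler's identity writes `F` in terms of forms of lower degree.
    have hi : ∀ i, IsTernaryForm (n + 1) fun a b c =>
        (fr.u i * a + fr.w i * b + p.rep i * c) * eval (fr.pt a b c) (pderiv i F) := fun i =>
      (ih (by simpa using hF.pderiv (i := i))).linear_mul _ _ _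
    refine ((((hi 0).add (hi 1)).add (hi 2)).smul ((n : ℂ) + 1)⁻¹).congr fun a b c => ?_
    have hE := congrArg (eval (fr.pt a b c)) hF.sum_X_mul_pderiv
    have hn : (n : ℂ) + 1 ≠ 0 := by exact_mod_cast n.succ_ne_zero
    rw [eq_inv_mul_iff_mul_eq₀ hn]
    simp only [Fin.sum_univ_three, map_add, map_mul, eval_X, nsmul_eq_mul,
      Nat.cast_add, Nat.cast_one, map_natCast, map_one] at hE
    simp only [Frame.pt, Pi.add_apply, Pi.smul_apply, smul_eq_mul] at hE ⊢
    rw [← hE]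
    ring

/-- `F = z² L + z Q + K` in the coordinates of the frame, with binary forms `L`, `Q`, `K` in `x`, `y`.
This is the expansion at `p` of a cubic form that vanishes at `p`; in particular `L = 0` is the
tangent line if `p` is a smooth point. -/
structure CubicExpansion {p : P2} (fr : Frame p) (F : Poly) (L Q K : ℂ → ℂ → ℂ) : Prop where
  isForm_one : IsBinaryForm 1 L
  isForm_two : IsBinaryForm 2 Q
  isForm_three : IsBinaryForm 3 K
  eval_eq : ∀ x y z, eval (fr.pt x y z) F = z ^ 2 * L x y + z * Q x y + K x y

theorem Frame.exists_cubicExpansion {p : P2} (fr : Frame p) {F : Poly} (hF : F.IsHomogeneous 3)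
    (hp : PassesThrough F p) : ∃ L Q K, CubicExpansion fr F L Q K := by
  obtain ⟨g, K, ⟨h, Q, ⟨k, L, ⟨c, hc⟩, hL, eL⟩, hQ, eQ⟩, hK, eK⟩ := fr.isTernaryForm hF
  beta_reduce at eK
  have hc0 : c = 0 := by
    have h0 := eK 0 0 1
    rw [eQ, eL, hc, hL.map_zero, hQ.map_zero, hK.map_zero, fr.pt_zero_zero_one, hp] at h0
    simpa using h0.symm
  exact ⟨L, Q, K, hL, hQ, hK, fun x y z => by rw [eK, eQ, eL, hc, hc0]; ring⟩

theorem eval_restrictToLine (F : Poly) (p : P2) (v : Fin 3 → ℂ) (t : ℂ) :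
    (restrictToLine F p v).eval t = eval (p.rep + t • v) F := by
  unfold restrictToLine
  induction F using MvPolynomial.induction_on with
  | C a => simp
  | add F G hF hG => simp [hF, hG]
  | mul_X F i hF =>
    rw [map_mul, Polynomial.eval_mul, hF, map_mul, aeval_X, eval_X]
    congr 1
    simp only [Polynomial.eval_add, Polynomial.eval_mul, Polynomial.eval_C, Polynomial.eval_X,
      Pi.add_apply, Pi.smul_apply, smul_eq_mul]
    ring

theorem differential_eq_coeff (F : Poly) (p : P2) (v : Fin 3 → ℂ) :
    differential F p v = (restrictToLine F p v).coeff 1 := by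
  unfold differential
  induction F using MvPolynomial.induction_on with
  | C a => simp [restrictToLine]
  | add F G hF hG =>
    rw [restrictToLine, map_add, Polynomial.coeff_add, ← restrictToLine, ← restrictToLine, ← hF,
      ← hG]
    simp [add_mul, Finset.sum_add_distrib]
  | mul_X F i hF =>
    have h0 : (restrictToLine F p v).coeff 0 = eval p.rep F := by
      rw [Polynomial.coeff_zero_eq_eval_zero, eval_restrictToLine]
      simp
    rw [restrictToLine, map_mul, aeval_X, ← restrictToLine, mul_add, Polynomial.coeff_add,
      Polynomial.coeff_mul_C, ← mul_assoc, Polynomial.coeff_mul_X, Polynomial.coeff_mul_C, h0, ← hF]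
    simp [pderiv_X, Pi.single_apply, add_mul, Finset.sum_add_distrib, Finset.sum_mul,
      apply_ite (eval p.rep), ite_mul]
    rw [add_comm]
    exact congrArg (· + _) (Finset.sum_congr rfl fun j _ => by ring)

namespace CubicExpansion

variable {p : P2} {fr : Frame p} {F G : Poly} {L Q K L' Q' K' : ℂ → ℂ → ℂ}

theorem add (hF : CubicExpansion fr F L Q K) (hG : CubicExpansion fr G L' Q' K') :
    CubicExpansion fr (F + G) (fun x y => L x y + L' x y) (fun x y => Q x y + Q' x y)
      (fun x y => K x y + K' x y) :=
  ⟨hF.1.add hG.1, hF.2.add hG.2, hF.3.add hG.3, fun x y z => by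
    rw [map_add, hF.eval_eq, hG.eval_eq]; ring⟩

theorem smul (hF : CubicExpansion fr F L Q K) (c : ℂ) :
    CubicExpansion fr (c • F) (fun x y => c * L x y) (fun x y => c * Q x y)
      (fun x y => c * K x y) :=
  ⟨hF.1.smul c, hF.2.smul c, hF.3.smul c, fun x y z => by
    rw [smul_eval, hF.eval_eq]; ring⟩

theorem restrictToLine_pt (hF : CubicExpansion fr F L Q K) (x y z : ℂ) :
    restrictToLine F p (fr.pt x y z) =
      .X * .C (L x y) + .X ^ 2 * (.C (2 * z * L x y + Q x y)) +
        .X ^ 3 * .C (z ^ 2 * L x y + z * Q x y + K x y) := by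
  refine Polynomial.funext fun t => ?_
  have : p.rep + t • fr.pt x y z = fr.pt (t * x) (t * y) (1 + t * z) := by
    simp only [Frame.pt]
    module
  rw [eval_restrictToLine, this, hF.eval_eq, hF.isForm_one.map_smul, hF.isForm_two.map_smul,
    hF.isForm_three.map_smul]
  simp
  ring

theorem differential_pt (hF : CubicExpansion fr F L Q K) (x y z : ℂ) :
    differential F p (fr.pt x y z) = L x y := by
  rw [differential_eq_coeff, hF.restrictToLine_pt]
  simp [Polynomial.coeff_X_pow_mul']

end CubicExpansion

/-! ### Cubics through seven points in general position -/

/-- `differential` as a linear map in the polynomial. -/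
def differentialₗ (p : P2) (v : Fin 3 → ℂ) : Poly →ₗ[ℂ] ℂ where
  toFun F := differential F p v
  map_add' F G := by simp [differential, add_mul, Finset.sum_add_distrib]
  map_smul' c F := by simp [differential, Finset.mul_sum, mul_assoc]

@[simp] theorem differentialₗ_apply (p : P2) (v : Fin 3 → ℂ) (F : Poly) :
    differentialₗ p v F = differential F p v := rfl

theorem differential_line_mul {p : P2} (fr : Frame p) (F : Poly) (a b x y z : ℂ) :
    differential ((C a * fr.x + C b * fr.y) * F) p (fr.pt x y z) =
      (a * x + b * y) * eval p.rep F := by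
  have h : restrictToLine (C a * fr.x + C b * fr.y) p (fr.pt x y z) =
      .C (a * x + b * y) * .X := by
    refine Polynomial.funext fun t => ?_
    have : p.rep + t • fr.pt x y z = fr.pt (t * x) (t * y) (1 + t * z) := by
      simp only [Frame.pt]
      module
    rw [eval_restrictToLine, this]
    simp
    ring
  rw [differential_eq_coeff, restrictToLine, map_mul, ← restrictToLine, ← restrictToLine, h,
    mul_assoc, Polynomial.coeff_C_mul, Polynomial.coeff_X_mul, Polynomial.coeff_zero_eq_eval_zero,
    eval_restrictToLine, zero_smul, add_zero]

namespace Frame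

variable {p : P2} (fr : Frame p)

theorem isHomogeneous_line (a b : ℂ) : (C a * fr.x + C b * fr.y).IsHomogeneous 1 :=
  (fr.isHomogeneous_x.C_mul a).add (fr.isHomogeneous_y.C_mul b)

theorem passesThrough_line (a b : ℂ) : PassesThrough (C a * fr.x + C b * fr.y) p := by
  rw [PassesThrough, ← fr.pt_zero_zero_one]
  simp

theorem line_ne_zero {a b : ℂ} (hab : a ≠ 0 ∨ b ≠ 0) : C a * fr.x + C b * fr.y ≠ 0 := by
  intro h
  have ha := congrArg (eval (fr.pt 1 0 0)) h
  have hb := congrArg (eval (fr.pt 0 1 0)) h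
  simp at ha hb
  tauto

end Frame

theorem CubicExpansion.passesThrough_iff {p : P2} {fr : Frame p} {F : Poly} {L Q K : ℂ → ℂ → ℂ}
    (hF : CubicExpansion fr F L Q K) (r : P2) :
    PassesThrough F r ↔ eval r.rep fr.z ^ 2 * L (eval r.rep fr.x) (eval r.rep fr.y) +
      eval r.rep fr.z * Q (eval r.rep fr.x) (eval r.rep fr.y) +
      K (eval r.rep fr.x) (eval r.rep fr.y) = 0 := by
  rw [← hF.eval_eq, ← fr.eq_pt, PassesThrough]

namespace GeneralPosition

variable {P : Fin 7 → P2} (hP : GeneralPosition P) (fr : Frame (P 0))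

include hP

/-- The lines joining `P 0` to the other points are distinct. -/
theorem det_ne_zero {i j : Fin 7} (hi : i ≠ 0) (hj : j ≠ 0) (hij : i ≠ j) :
    eval (P i).rep fr.x * eval (P j).rep fr.y - eval (P i).rep fr.y * eval (P j).rep fr.x ≠ 0 := by
  intro hdet
  obtain ⟨a, b, hab, h₁, h₂⟩ : ∃ a b : ℂ, (a ≠ 0 ∨ b ≠ 0) ∧
      a * eval (P i).rep fr.x + b * eval (P i).rep fr.y = 0 ∧
      a * eval (P j).rep fr.x + b * eval (P j).rep fr.y = 0 := by
    by_cases h : eval (P i).rep fr.x ≠ 0 ∨ eval (P i).rep fr.y ≠ 0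
    · exact ⟨-eval (P i).rep fr.y, eval (P i).rep fr.x, by rw [neg_ne_zero]; exact h.symm,
        by ring, by linear_combination hdet⟩
    · push Not at h
      rw [h.1, h.2]
      by_cases h' : eval (P j).rep fr.x ≠ 0 ∨ eval (P j).rep fr.y ≠ 0
      · exact ⟨-eval (P j).rep fr.y, eval (P j).rep fr.x, by rw [neg_ne_zero]; exact h'.symm,
          by ring, by ring⟩
      · push Not at h'
        rw [h'.1, h'.2]
        exact ⟨1, 0, by simp, by ring, by ring⟩
  obtain ⟨l, hl, hFl⟩ := hP.no_three_on_line {0, i, j}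
    (Finset.card_eq_three.2 ⟨0, i, j, hi.symm, hj.symm, hij, rfl⟩) _
    (fr.isHomogeneous_line a b) (fr.line_ne_zero hab)
  simp only [Finset.mem_insert, Finset.mem_singleton] at hl
  rcases hl with rfl | rfl | rfl
  · exact hFl (fr.passesThrough_line a b)
  · exact hFl (by simpa [PassesThrough] using h₁)
  · exact hFl (by simpa [PassesThrough] using h₂)

theorem coord_ne_zero {i : Fin 7} (hi : i ≠ 0) :
    eval (P i).rep fr.x ≠ 0 ∨ eval (P i).rep fr.y ≠ 0 := by
  obtain ⟨j, hj, hij⟩ : ∃ j : Fin 7, j ≠ 0 ∧ i ≠ j := by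
    revert i
    decide
  by_contra h
  push Not at h
  exact hP.det_ne_zero fr hi hj hij (by rw [h.1, h.2]; ring)

/-- The line through `P 0` and `P k`, together with the conic through the other five points, is a
cubic of the net which is smooth at `P 0`. -/
theorem exists_mem_cubicsThrough_tangent {k : Fin 7} (hk : k ≠ 0) :
    ∃ F ∈ cubicsThrough P, ∃ e : ℂ, e ≠ 0 ∧ ∀ x y z, differential F (P 0) (fr.pt x y z) =
      e * (x * eval (P k).rep fr.y - y * eval (P k).rep fr.x) := by
  obtain ⟨G, hG, hG0, hGS⟩ := exists_curve_passesThrough P ((Finset.univ.erase k).erase 0) (d := 2)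
    (by
      rw [Finset.card_erase_of_mem (by simpa using hk.symm), Finset.card_erase_of_mem (by simp)]
      decide)
  have hG0' : ¬ PassesThrough G (P 0) := by
    obtain ⟨i, hi, hiG⟩ := hP.no_six_on_conic (Finset.univ.erase k)
      (by rw [Finset.card_erase_of_mem (by simp)]; rfl) G hG hG0
    by_cases h : i = 0
    · rwa [h] at hiG
    · exact absurd (hGS i (Finset.mem_erase.2 ⟨h, hi⟩)) hiG
  refine ⟨(C (eval (P k).rep fr.y) * fr.x + C (-eval (P k).rep fr.x) * fr.y) * G,
    ⟨(fr.isHomogeneous_line _ _).mul hG, fun i => passesThrough_mul.2 ?_⟩,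
    eval (P 0).rep G, hG0', fun x y z => ?_⟩
  · by_cases h0 : i = 0
    · rw [h0]
      exact Or.inl (fr.passesThrough_line _ _)
    by_cases h : i = k
    · rw [h]
      exact Or.inl (by simp [PassesThrough]; ring)
    · exact Or.inr (hGS i (by simp [h, h0]))
  · rw [differential_line_mul]
    ring

theorem exists_singular_cubic :
    ∃ N ∈ cubicsThrough P, N ≠ 0 ∧ ∃ q c, CubicExpansion fr N (fun _ _ => 0) q c := by
  let φ : cubicsThrough P →ₗ[ℂ] Fin 2 → ℂ := LinearMap.pi
    ![(differentialₗ (P 0) (fr.pt 1 0 0)).domRestrict _,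
      (differentialₗ (P 0) (fr.pt 0 1 0)).domRestrict _]
  have hker : LinearMap.ker φ ≠ ⊥ := LinearMap.ker_ne_bot_of_finrank_lt (by
    rw [finrank_cubicsThrough hP.no_three_on_line, Module.finrank_fintype_fun_eq_card,
      Fintype.card_fin]
    decide)
  obtain ⟨⟨N, hN⟩, hNφ, hN0⟩ := Submodule.exists_mem_ne_zero_of_ne_bot hker
  refine ⟨N, hN, fun h => hN0 (Subtype.ext h), ?_⟩
  obtain ⟨L, q, c, hexp⟩ := fr.exists_cubicExpansion hN.1 (hN.2 0)
  have hx : L 1 0 = 0 := by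
    rw [← hexp.differential_pt 1 0 0]
    exact congrFun (LinearMap.mem_ker.1 hNφ) 0
  have hy : L 0 1 = 0 := by
    rw [← hexp.differential_pt 0 1 0]
    exact congrFun (LinearMap.mem_ker.1 hNφ) 1
  obtain ⟨a, b, hL⟩ := hexp.isForm_one.exists_eq_linear
  obtain rfl : L = fun _ _ => 0 := by
    funext x y
    rw [hL] at hx hy ⊢
    linear_combination x * hx + y * hy
  exact ⟨q, c, hexp⟩

/-- The singular cubic contains no line through its singular point: the residual conic would pass
through `P 0` and five other points. -/
theorem not_common_zero {N : Poly} (hN : N ∈ cubicsThrough P) (hN0 : N ≠ 0) {q c : ℂ → ℂ → ℂ}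
    (hexp : CubicExpansion fr N (fun _ _ => 0) q c) {a b : ℂ} (hab : a ≠ 0 ∨ b ≠ 0)
    (hq : q a b = 0) : c a b ≠ 0 := by
  intro hc
  obtain ⟨q', hq', eq⟩ := hexp.isForm_two.exists_eq_linear_mul hab hq
  obtain ⟨c', hc', ec⟩ := hexp.isForm_three.exists_eq_linear_mul hab hc
  obtain ⟨A, hA, eA⟩ := hq'.exists_poly fr.isHomogeneous_x fr.isHomogeneous_y
  obtain ⟨B, hB, eB⟩ := hc'.exists_poly fr.isHomogeneous_x fr.isHomogeneous_y
  have hGhom : (fr.z * A + B).IsHomogeneous 2 := (fr.isHomogeneous_z.mul hA).add hB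
  have hNG : ∀ v, eval v N =
      (eval v fr.x * b - eval v fr.y * a) * eval v (fr.z * A + B) := fun v => by
    rw [map_add, map_mul, eA, eB]
    conv_lhs => rw [fr.eq_pt v, hexp.eval_eq, eq, ec]
    ring
  have hG0 : fr.z * A + B ≠ 0 := fun h => hN0 (MvPolynomial.funext fun v => by
    rw [hNG, h]; simp)
  have hGP : PassesThrough (fr.z * A + B) (P 0) := by
    rw [PassesThrough, ← fr.pt_zero_zero_one, map_add, map_mul, eA, eB]
    simp [hq'.map_zero, hc'.map_zero]
  -- All the points other than `P 0` and one more point `P k` are off the line.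
  obtain ⟨k, hk, hline⟩ : ∃ k : Fin 7, k ≠ 0 ∧ ∀ i, i ≠ 0 → i ≠ k →
      eval (P i).rep fr.x * b - eval (P i).rep fr.y * a ≠ 0 := by
    by_cases h : ∃ k, k ≠ 0 ∧ eval (P k).rep fr.x * b - eval (P k).rep fr.y * a = 0
    · obtain ⟨k, hk, hk0⟩ := h
      refine ⟨k, hk, fun i hi hik hi0 => hP.det_ne_zero fr hi hk hik ?_⟩
      obtain ⟨m, hx, hy⟩ := eq_mul_of_det_eq_zero hab hk0
      obtain ⟨m', hx', hy'⟩ := eq_mul_of_det_eq_zero hab hi0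
      rw [hx, hy, hx', hy']
      ring
    · push Not at h
      exact ⟨1, by decide, fun i hi _ => h i hi⟩
  obtain ⟨i, hi, hiG⟩ := hP.no_six_on_conic (Finset.univ.erase k)
    (by rw [Finset.card_erase_of_mem (by simp)]; rfl) _ hGhom hG0
  rcases eq_or_ne i 0 with rfl | h0
  · exact hiG hGP
  · have hNi := hN.2 i
    rw [PassesThrough, hNG] at hNi
    exact hiG ((mul_eq_zero.1 hNi).resolve_left (hline i h0 (Finset.ne_of_mem_erase hi)))

/-- The cubic `z q + c = 0` is parametrized by `(x, y) ↦ (x q, y q, -c)`. Restricted to it, a cubic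
of the net is `q` times the form `L c² - q Q c + q² K` of degree seven, which vanishes at the
parameters of the six points other than `P 0`. -/
theorem exists_residual_eq {N : Poly} (hN : N ∈ cubicsThrough P) {q c : ℂ → ℂ → ℂ}
    (hexp : CubicExpansion fr N (fun _ _ => 0) q c) {F : Poly} (hF : F ∈ cubicsThrough P)
    {L Q K : ℂ → ℂ → ℂ} (hFexp : CubicExpansion fr F L Q K) :
    ∃ g, IsBinaryForm 1 g ∧ ∀ x y,
      L x y * c x y ^ 2 - q x y * Q x y * c x y + q x y ^ 2 * K x y =
      (∏ i ∈ Finset.univ.erase (0 : Fin 7),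
        (x * eval (P i).rep fr.y - y * eval (P i).rep fr.x)) * g x y := by
  have hform : IsBinaryForm 7 fun x y =>
      L x y * c x y ^ 2 - q x y * Q x y * c x y + q x y ^ 2 * K x y := by
    have h₁ := hFexp.isForm_one.mul (hexp.isForm_three.mul hexp.isForm_three)
    have h₂ := hexp.isForm_two.mul (hFexp.isForm_two.mul hexp.isForm_three)
    have h₃ := hexp.isForm_two.mul (hexp.isForm_two.mul hFexp.isForm_three)
    exact ((h₁.add (h₂.smul (-1))).add h₃).congr fun x y => by ring
  refine hform.exists_eq_prod_mul (n := 1) (Finset.univ.erase (0 : Fin 7))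
    (fun i hi => hP.coord_ne_zero fr (Finset.ne_of_mem_erase hi)) (fun i _ => ?_)
    (fun i hi j hj => hP.det_ne_zero fr (Finset.ne_of_mem_erase hi) (Finset.ne_of_mem_erase hj))
  have h₁ := (hexp.passesThrough_iff (P i)).1 (hN.2 i)
  have h₂ := (hFexp.passesThrough_iff (P i)).1 (hF.2 i)
  set x := eval (P i).rep fr.x
  set y := eval (P i).rep fr.y
  set z := eval (P i).rep fr.z
  rw [mul_zero, zero_add] at h₁
  have hc : c x y = -(z * q x y) := by linear_combination h₁
  rw [hc]
  linear_combination q x y ^ 2 * h₂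

end GeneralPosition

/-- If a cubic `z² L + z Q + K = 0` that is smooth at the origin contained the cubic `z q + c = 0`,
then `q` would divide `L c²`, hence `L`; but `q` has degree two. -/
theorem exists_residual_ne_zero {L Q K q c : ℂ → ℂ → ℂ} (hL : IsBinaryForm 1 L)
    (hQ : IsBinaryForm 2 Q) (hK : IsBinaryForm 3 K) (hq : IsBinaryForm 2 q)
    (hc : IsBinaryForm 3 c)
    (hqc : ∀ a b, (a ≠ 0 ∨ b ≠ 0) → q a b = 0 → c a b ≠ 0) (hL0 : ∃ x y, L x y ≠ 0) :
    ∃ x y, L x y * c x y ^ 2 - q x y * Q x y * c x y + q x y ^ 2 * K x y ≠ 0 := by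
  by_contra! h
  obtain ⟨a, b, hab, hqab⟩ := hq.exists_root
  have hLab : L a b = 0 := by
    have := h a b
    rw [hqab] at this
    simpa [hqc a b hab hqab] using this
  obtain ⟨l, ⟨d, hd⟩, eL⟩ := hL.exists_eq_linear_mul hab hLab
  obtain ⟨m, hm, em⟩ := hq.exists_eq_linear_mul hab hqab
  have hform : IsBinaryForm 6 fun x y =>
      d * c x y ^ 2 - m x y * Q x y * c x y + m x y * q x y * K x y := by
    have h₁ := (hc.mul hc).smul d
    have h₂ := hm.mul (hQ.mul hc)
    have h₃ := hm.mul (hq.mul hK)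
    exact ((h₁.add (h₂.smul (-1))).add h₃).congr fun x y => by ring
  have hzero := hform.eq_zero_of_linear_mul hab fun x y => by
    have := h x y
    rw [eL, hd] at this
    linear_combination this + (Q x y * c x y - q x y * K x y) * em x y
  obtain ⟨a', b', hab', hm'⟩ := hm.exists_root
  have hc' := hqc a' b' hab' (by rw [em, hm', mul_zero])
  have hd0 : d = 0 := by simpa [hm', hc'] using hzero a' b'
  obtain ⟨x, y, hxy⟩ := hL0
  exact hxy (by rw [eL, hd, hd0, mul_zero])

namespace GeneralPosition

variable {P : Fin 7 → P2} (hP : GeneralPosition P) (fr : Frame (P 0))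

include hP

/-- Some cubic of the net is smooth at `P 0`, and on the singular cubic `z q + c = 0` its residual
form of degree seven vanishes at the parameters of the points `P i`, `i ≠ 0`, only; the one at
`P 1` is then a double zero. -/
theorem exists_cubic_residual_zeros {N : Poly} (hN : N ∈ cubicsThrough P) (hN0 : N ≠ 0)
    {q c : ℂ → ℂ → ℂ} (hexp : CubicExpansion fr N (fun _ _ => 0) q c) :
    ∃ H ∈ cubicsThrough P, ∃ L Q K, CubicExpansion fr H L Q K ∧ (∃ x y, L x y ≠ 0) ∧
      ∀ x y, L x y * c x y ^ 2 - q x y * Q x y * c x y + q x y ^ 2 * K x y = 0 →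
        ∃ i : Fin 7, i ≠ 0 ∧ ∃ m, x = m * eval (P i).rep fr.x ∧ y = m * eval (P i).rep fr.y := by
  have h12 := hP.det_ne_zero fr (i := 1) (j := 2) (by decide) (by decide) (by decide)
  obtain ⟨F, hF, e, he, hFd⟩ := hP.exists_mem_cubicsThrough_tangent fr (k := 1) (by decide)
  obtain ⟨G, hG, e', he', hGd⟩ := hP.exists_mem_cubicsThrough_tangent fr (k := 2) (by decide)
  obtain ⟨LF, QF, KF, hFexp⟩ := fr.exists_cubicExpansion hF.1 (hF.2 0)
  obtain ⟨LG, QG, KG, hGexp⟩ := fr.exists_cubicExpansion hG.1 (hG.2 0)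
  obtain ⟨f, hf, hfres⟩ := hP.exists_residual_eq fr hN hexp hF hFexp
  obtain ⟨g, hg, hgres⟩ := hP.exists_residual_eq fr hN hexp hG hGexp
  set s : Fin 7 → ℂ := fun i => eval (P i).rep fr.x
  set t : Fin 7 → ℂ := fun i => eval (P i).rep fr.y
  -- A combination whose residual form has its seventh zero at the parameter of `P 1`.
  obtain ⟨α, β, hαβ, hzero⟩ : ∃ α β : ℂ, (α ≠ 0 ∨ β ≠ 0) ∧
      α * f (s 1) (t 1) + β * g (s 1) (t 1) = 0 := by
    by_cases h : f (s 1) (t 1) = 0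
    · exact ⟨1, 0, by simp, by simp [h]⟩
    · exact ⟨-g (s 1) (t 1), f (s 1) (t 1), Or.inr h, by ring⟩
  have hH := (hFexp.smul α).add (hGexp.smul β)
  have hL0 : ∃ x y, α * LF x y + β * LG x y ≠ 0 := by
    have hLF : ∀ x y, LF x y = e * (x * t 1 - y * s 1) := fun x y => by
      rw [← hFexp.differential_pt x y 0, hFd]
    have hLG : ∀ x y, LG x y = e' * (x * t 2 - y * s 2) := fun x y => by
      rw [← hGexp.differential_pt x y 0, hGd]
    rcases hαβ with h | h
    · refine ⟨s 2, t 2, ?_⟩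
      rw [hLF, hLG, show α * (e * (s 2 * t 1 - t 2 * s 1)) + β * (e' * (s 2 * t 2 - t 2 * s 2)) =
        -(α * e * (s 1 * t 2 - t 1 * s 2)) by ring]
      exact neg_ne_zero.2 (mul_ne_zero (mul_ne_zero h he) h12)
    · refine ⟨s 1, t 1, ?_⟩
      rw [hLF, hLG, show α * (e * (s 1 * t 1 - t 1 * s 1)) + β * (e' * (s 1 * t 2 - t 1 * s 2)) =
        β * e' * (s 1 * t 2 - t 1 * s 2) by ring]
      exact mul_ne_zero (mul_ne_zero h he') h12
  refine ⟨_, add_mem ((cubicsThrough P).smul_mem α hF) ((cubicsThrough P).smul_mem β hG), _, _, _,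
    hH, hL0, fun x y hxy => ?_⟩
  have hres : ∀ x y, (α * LF x y + β * LG x y) * c x y ^ 2 -
      q x y * (α * QF x y + β * QG x y) * c x y + q x y ^ 2 * (α * KF x y + β * KG x y) =
      (∏ i ∈ Finset.univ.erase (0 : Fin 7), (x * t i - y * s i)) *
        (α * f x y + β * g x y) := fun x y => by
    linear_combination α * hfres x y + β * hgres x y
  have hcoord : ∀ i, i ≠ 0 → s i ≠ 0 ∨ t i ≠ 0 := fun i hi => hP.coord_ne_zero fr hi
  obtain ⟨k, ⟨d, hd⟩, hk⟩ := ((hf.smul α).add (hg.smul β)).exists_eq_linear_mul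
    (hcoord 1 (by decide)) hzero
  have hd0 : d ≠ 0 := by
    rintro rfl
    obtain ⟨x, y, hne⟩ := exists_residual_ne_zero hH.isForm_one hH.isForm_two hH.isForm_three
      hexp.isForm_two hexp.isForm_three
      (fun a b hab => hP.not_common_zero fr hN hN0 hexp hab) hL0
    exact hne (by rw [hres, hk, hd]; ring)
  have hxy' : (∏ i ∈ Finset.univ.erase (0 : Fin 7), (x * t i - y * s i)) *
      ((x * t 1 - y * s 1) * d) = 0 := by
    rw [← hd x y, ← hk, ← hres]
    exact hxy
  obtain ⟨i, hi, hi0⟩ : ∃ i : Fin 7, i ≠ 0 ∧ x * t i - y * s i = 0 := by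
    rcases mul_eq_zero.1 hxy' with h | h
    · obtain ⟨i, hi, h⟩ := Finset.prod_eq_zero_iff.1 h
      exact ⟨i, Finset.ne_of_mem_erase hi, h⟩
    · exact ⟨1, by decide, (mul_eq_zero.1 h).resolve_right hd0⟩
  exact ⟨i, hi, eq_mul_of_det_eq_zero (hcoord i hi) hi0⟩

end GeneralPosition

theorem eq_of_rep_eq_smul {p r : P2} {m : ℂ} (h : p.rep = m • r.rep) : p = r := by
  rw [← p.mk_rep, ← r.mk_rep, Projectivization.mk_eq_mk_iff']
  exact ⟨m, h.symm⟩

/-- The cubics of a net whose tangent direction at a point is prescribed form a pencil. -/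
theorem finrank_inf_ker_differentialₗ {W : Submodule ℂ Poly} (hW : Module.finrank ℂ W = 3) {p : P2}
    {v : Fin 3 → ℂ} {F : Poly} (hF : F ∈ W) (hv : differential F p v ≠ 0) :
    Module.finrank ℂ (W ⊓ LinearMap.ker (differentialₗ p v) : Submodule ℂ Poly) = 2 := by
  have : FiniteDimensional ℂ W := Module.finite_of_finrank_pos (by omega)
  let φ : Module.Dual ℂ W := (differentialₗ p v).domRestrict W
  have hφ : φ ≠ 0 := fun h => hv (LinearMap.congr_fun h ⟨F, hF⟩)
  have hrank := Module.Dual.finrank_ker_add_one_of_ne_zero hφ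
  have hmap : W ⊓ LinearMap.ker (differentialₗ p v) = (LinearMap.ker φ).map W.subtype := by
    ext Z
    simp [φ, and_comm]
  rw [hmap, Submodule.finrank_map_subtype_eq]
  omega

namespace GeneralPosition

variable {P : Fin 7 → P2} (hP : GeneralPosition P)

include hP

theorem exists_unruly_pencil :
    ∃ V : Submodule ℂ Poly, V ≤ cubicsThrough P ∧ Module.finrank ℂ V = 2 ∧
      baseLocus V ⊆ Set.range P ∧ ∃ C ∈ cubicsThrough P, IsInflectionPoint C (P 0) ∧
        ∀ Z : Poly, Z ∈ V ↔ Z ∈ cubicsThrough P ∧ IsTangentTo Z C (P 0) := by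
  obtain ⟨fr⟩ : Nonempty (Frame (P 0)) := inferInstance
  obtain ⟨N, hN, hN0, q, c, hexp⟩ := hP.exists_singular_cubic fr
  have hqc : ∀ a b, (a ≠ 0 ∨ b ≠ 0) → q a b = 0 → c a b ≠ 0 :=
    fun a b hab => hP.not_common_zero fr hN hN0 hexp hab
  obtain ⟨H, hH, L, Q, K, hHexp, ⟨x₀, y₀, hL0⟩, hzeros⟩ :=
    hP.exists_cubic_residual_zeros fr hN hN0 hexp
  -- `(a, b)` is the common tangent direction.
  obtain ⟨a, b, hab, hLab⟩ := hHexp.isForm_one.exists_root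
  have hL : ∀ x y, L x y = 0 → ∃ m, x = m * a ∧ y = m * b := fun x y hxy => by
    refine eq_mul_of_det_eq_zero hab ?_
    obtain ⟨l, ⟨d, hd⟩, hl⟩ := hHexp.isForm_one.exists_eq_linear_mul hab hLab
    rw [hl, hd] at hL0 hxy
    exact (mul_eq_zero.1 hxy).resolve_right (right_ne_zero_of_mul hL0)
  -- The points other than `P 0` lie off the tangent lines `q = 0` of the singular cubic.
  have hqi : ∀ i, i ≠ 0 → q (eval (P i).rep fr.x) (eval (P i).rep fr.y) ≠ 0 := fun i hi h => by
    have hNi := (hexp.passesThrough_iff (P i)).1 (hN.2 i)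
    rw [h] at hNi
    exact hqc _ _ (hP.coord_ne_zero fr hi) h (by simpa using hNi)
  have hqab : q a b ≠ 0 := fun h => by
    obtain ⟨i, hi, m, hx, hy⟩ := hzeros a b (by rw [hLab, h]; ring)
    rw [hx, hy, hexp.isForm_two.map_smul] at h
    have hm : m ≠ 0 := by
      rintro rfl
      simp [hx, hy] at hab
    exact mul_ne_zero (pow_ne_zero 2 hm) (hqi i hi) h
  -- Adding a multiple of the singular cubic makes the quadratic term vanish on the tangent line.
  set k : ℂ := -(Q a b / q a b)
  have hC := hHexp.add (hexp.smul k)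
  have hLC : ∀ x y z, differential (H + k • N) (P 0) (fr.pt x y z) = L x y := fun x y z => by
    rw [hC.differential_pt, mul_zero, add_zero]
  have hQC : Q a b + k * q a b = 0 := by
    simp only [k]
    field_simp
    ring
  have hCmem : H + k • N ∈ cubicsThrough P := add_mem hH ((cubicsThrough P).smul_mem k hN)
  refine ⟨cubicsThrough P ⊓ LinearMap.ker (differentialₗ (P 0) (fr.pt a b 0)), inf_le_left, ?_,
    fun p hp => ?_, H + k • N, hCmem, ⟨⟨hCmem.2 0, fr.pt x₀ y₀ 0, by rwa [hLC]⟩, fun v hv => ?_⟩,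
    fun Z => ⟨fun hZ => ⟨hZ.1, hZ.1.2 0, fun v hv => ?_⟩, fun hZ => ⟨hZ.1, hZ.2.2 _ ?_⟩⟩⟩
  · have h12 := hP.det_ne_zero fr (i := 1) (j := 2) (by decide) (by decide) (by decide)
    obtain ⟨F, hF, hFd⟩ : ∃ F ∈ cubicsThrough P, differential F (P 0) (fr.pt a b 0) ≠ 0 := by
      by_contra! h
      have hdet : ∀ i : Fin 7, i ≠ 0 →
          eval (P i).rep fr.x * b - eval (P i).rep fr.y * a = 0 := fun i hi => by
        obtain ⟨F, hF, e, he, hFd⟩ := hP.exists_mem_cubicsThrough_tangent fr hi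
        have h0 := h F hF
        rw [hFd] at h0
        linear_combination -(mul_eq_zero.1 h0).resolve_left he
      obtain ⟨m, hx, hy⟩ := eq_mul_of_det_eq_zero hab (hdet 1 (by decide))
      obtain ⟨m', hx', hy'⟩ := eq_mul_of_det_eq_zero hab (hdet 2 (by decide))
      exact h12 (by rw [hx, hy, hx', hy']; ring)
    exact finrank_inf_ker_differentialₗ (finrank_cubicsThrough hP.no_three_on_line) hF hFd
  · have hNp := (hexp.passesThrough_iff p).1 (hp N ⟨hN, by simp [hexp.differential_pt]⟩)
    have hHp := (hHexp.passesThrough_iff p).1 (hp H ⟨hH, by simp [hHexp.differential_pt, hLab]⟩)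
    have hrep := fr.eq_pt p.rep
    set x := eval p.rep fr.x
    set y := eval p.rep fr.y
    set z := eval p.rep fr.z
    rw [mul_zero, zero_add] at hNp
    by_cases hxy : x = 0 ∧ y = 0
    · refine ⟨0, (eq_of_rep_eq_smul (m := z) ?_).symm⟩
      rw [hrep, hxy.1, hxy.2]
      simp [Frame.pt]
    have hcz : c x y = -(z * q x y) := by linear_combination hNp
    obtain ⟨i, hi, m, hx, hy⟩ := hzeros x y (by
      rw [hcz]
      linear_combination q x y ^ 2 * hHp)
    have hm : m ≠ 0 := by
      rintro rfl
      exact hxy (by simp [hx, hy])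
    have hNi := (hexp.passesThrough_iff (P i)).1 (hN.2 i)
    have hrepi := fr.eq_pt (P i).rep
    have hz : z = m * eval (P i).rep fr.z := by
      rw [hx, hy, hexp.isForm_two.map_smul, hexp.isForm_three.map_smul] at hNp
      refine mul_right_cancel₀ (mul_ne_zero (pow_ne_zero 2 hm) (hqi i hi)) ?_
      linear_combination hNp - m ^ 3 * hNi
    refine ⟨i, (eq_of_rep_eq_smul (m := m) ?_).symm⟩
    rw [hrep, hx, hy, hz]
    conv_rhs => rw [hrepi]
    simp only [Frame.pt]
    module
  · rw [fr.eq_pt v, hLC] at hv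
    obtain ⟨m, hx, hy⟩ := hL _ _ hv
    rw [fr.eq_pt v, hC.restrictToLine_pt, mul_zero, add_zero, hv, hx, hy,
      (hC.isForm_two).map_smul, hQC]
    simp
  · rw [fr.eq_pt v, hLC] at hv
    obtain ⟨m, hx, hy⟩ := hL _ _ hv
    obtain ⟨L', Q', K', hZexp⟩ := fr.exists_cubicExpansion hZ.1.1 (hZ.1.2 0)
    have hZab : L' a b = 0 := by
      rw [← hZexp.differential_pt a b 0]
      exact hZ.2
    rw [fr.eq_pt v, hZexp.differential_pt, hx, hy, hZexp.isForm_one.map_smul, hZab, mul_zero]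
  · rw [hLC, hLab]

end GeneralPosition

end PlaneCurves

end

theorem proposition2p1 (P : Fin 7 → PlaneCurves.P2) (hP : PlaneCurves.GeneralPosition P) :
    Module.finrank ℂ (PlaneCurves.cubicsThrough P) = 3 ∧
    PlaneCurves.baseLocus (PlaneCurves.cubicsThrough P) = Set.range P ∧
    ∀ W : Submodule ℂ PlaneCurves.Poly,
      W ≤ PlaneCurves.cubicsThrough P → Module.finrank ℂ W = 3 →
      W = PlaneCurves.cubicsThrough P ∧
      ∃ V : Submodule ℂ PlaneCurves.Poly, PlaneCurves.IsUnrulyPencil V W ∧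
        ∃ C ∈ W, PlaneCurves.IsInflectionPoint C (P 0) ∧
          ∀ Z : PlaneCurves.Poly, Z ∈ V ↔ Z ∈ W ∧ PlaneCurves.IsTangentTo Z C (P 0) := by
  have hrank := PlaneCurves.finrank_cubicsThrough hP.no_three_on_line
  obtain ⟨V, hV, hV2, hVbase, hVC⟩ := hP.exists_unruly_pencil
  have hle : PlaneCurves.baseLocus (PlaneCurves.cubicsThrough P) ⊆ PlaneCurves.baseLocus V :=
    fun p hp F hF => hp F (hV hF)
  have hbase : PlaneCurves.baseLocus (PlaneCurves.cubicsThrough P) = Set.range P := by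
    refine Set.Subset.antisymm (hle.trans hVbase) ?_
    rintro _ ⟨i, rfl⟩ F hF
    exact hF.2 i
  refine ⟨hrank, hbase, fun W hW hW3 => ?_⟩
  obtain rfl := Submodule.eq_of_le_of_finrank_eq hW (hW3.trans hrank.symm)
  exact ⟨rfl, V, ⟨hV, hV2, Set.Subset.antisymm (hbase ▸ hVbase) hle⟩, hVC⟩
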